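/- Let $\tau$ be a first-order vocabulary (in particular, any finite one); all $\tau$-structures have a non-empty universe. A structure $M$ is a *finitary covered extension* of a collection $R$ of structures if (i) $N \subseteq M$ is a substructure for every $N \in R$, and (ii) every finite subset of the universe of $M$ is contained in the universe of some $N \in R$. A class $S$ of $\tau$-structures is *preserved under finitary covered extensions* if, for every collection $R$ of structures in $S$, every finitary covered extension $M$ of $R$ is in $S$. Let $PCE_f$ be the collection of first-order sentences over $\tau$ whose class of models is preserved under finitary covered extensions. A $\Pi^0_2$ sentence is a prenex sentence whose quantifier prefix begins with $\forall$ and has exactly one alternation, i.e. a sentence $\forall x_1 \cdots \forall x_m \exists y_1 \cdots \exists y_n\, \theta$ with $m, n \ge 1$ and $\theta$ quantifier-free. **Theorem.** A first-order sentence $\phi$ over $\tau$ is in $PCE_f$ if and only if $\phi$ is logically equivalent to a $\Pi^0_2$ sentence over $\tau$. -/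

import Mathlib

universe u v w

namespace FirstOrder.Language

open CategoryTheory

variable {L : Language.{u, v}}

section Syntactic

variable {α : Type*}

/-- Prenex formulas `∃ y₁ … ∃ yₙ θ` with `n ≥ 1` and `θ` quantifier-free. -/
inductive IsSigmaOne : ∀ {n : ℕ}, L.BoundedFormula α n → Prop
  | ex_of_isQF {n : ℕ} {θ : L.BoundedFormula α (n + 1)} (h : θ.IsQF) : IsSigmaOne θ.ex
  | ex {n : ℕ} {θ : L.BoundedFormula α (n + 1)} (h : IsSigmaOne θ) : IsSigmaOne θ.ex

/-- Prenex formulas whose quantifier prefix begins with `∀` and has exactly one alternation: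
`∀ x₁ … ∀ xₘ ∃ y₁ … ∃ yₙ θ` with `m, n ≥ 1` and `θ` quantifier-free. -/
inductive IsPiTwo : ∀ {n : ℕ}, L.BoundedFormula α n → Prop
  | all_of_isSigmaOne {n : ℕ} {θ : L.BoundedFormula α (n + 1)} (h : IsSigmaOne θ) : IsPiTwo θ.all
  | all {n : ℕ} {θ : L.BoundedFormula α (n + 1)} (h : IsPiTwo θ) : IsPiTwo θ.all

end Syntactic

/-- A collection `R` of substructures of `M` (so that `M` is an extension of `R`) is a finitary
cover of `M`, equivalently `M` is a finitary covered extension of `R`, if every finite subset of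
the universe of `M` is contained in a member of `R`. -/
def IsFinitaryCover {M : Type w} [L.Structure M] (R : Set (L.Substructure M)) : Prop :=
  ∀ S : Set M, S.Finite → ∃ N ∈ R, S ⊆ (N : Set M)

/-- A class `K` of structures is preserved under finitary covered extensions: if all members of a
finitary cover of `M` belong to `K`, then so does `M`. -/
def PreservedUnderFinitaryCoveredExtensions (K : Set (Bundled.{w} L.Structure)) : Prop :=
  ∀ (M : Type w) [L.Structure M] (R : Set (L.Substructure M)), IsFinitaryCover R →
    (∀ N ∈ R, Bundled.of (c := L.Structure) N ∈ K) → Bundled.of (c := L.Structure) M ∈ K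

/-- The class of structures defined by a sentence. As usual in model theory, a structure has a
non-empty universe. -/
def modelClass (φ : L.Sentence) : Set (Bundled.{w} L.Structure) :=
  {M | Nonempty M ∧ M ⊨ φ}

end FirstOrder.Language

/-!
A `Π₂` sentence `∀ x ∃ y, θ` passes from a finitary cover to the whole structure: a tuple `x` lies
in some member of the cover, which contains a witness `y`, and quantifier-free formulas are
absolute between a structure and its substructures.

Conversely, let `φ` be preserved under finitary covered extensions. It suffices that `φ` follows
from the theory `piTwoConsequences φ` of its `Π₂` consequences, for then by compactness it follows
from finitely many of them, whose conjunction is again `Π₂`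
(`exists_isPiTwo_of_finset_subset_piTwoConsequences`). So let `M` be a model of this theory.

* For every finite tuple `a` of `M` there are `N ⊨ φ` and a tuple `b` of `N` such that all
  existential formulas true of `b` in `N` are true of `a` in `M`
  (`exists_model_existential_imp`).
* Hence `M` has an elementary extension into which all these `N` embed with `b` sent to `a`
  (`exists_elementaryEmbedding_forall_tuple`).
* Iterating `ω` times yields an elementary chain whose limit is an elementary extension of `M`, by
  the Tarski–Vaught theorem on chains, and has a finitary cover by models of `φ`
  (`exists_elementaryEmbedding_isFinitaryCover`). So the limit satisfies `φ`, and `M` does too.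

Both extension steps are ultraproducts over an ultrafilter on the finite subsets of a set, finer than
`Filter.atTop`, so that no constants have to be added to the language.
-/

open FirstOrder FirstOrder.Language.Theory

namespace FirstOrder.Language

variable {L : Language.{u, v}}

/-! ### `Π₂` sentences pass from a finitary cover to the whole structure -/

theorem IsSigmaOne.isExistential {α : Type*} {n : ℕ} {θ : L.BoundedFormula α n}
    (h : IsSigmaOne θ) : θ.IsExistential := by
  induction h with
  | ex_of_isQF h => exact h.isExistential.ex
  | ex _ ih => exact ih.ex

/-- If a property of tuples of `M` passes from all members of a cover to `M`, so does its universal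
quantification over the last entry. -/
theorem realize_all_of_forall_mem_cover {M : Type w} [L.Structure M] {R : Set (L.Substructure M)}
    {n : ℕ} {θ : L.BoundedFormula Empty (n + 1)}
    (ih : ∀ xs : Fin (n + 1) → M,
      (∀ N ∈ R, ∀ ys : Fin (n + 1) → N, (fun i => (ys i : M)) = xs → θ.Realize default ys) →
        θ.Realize default xs)
    (xs : Fin n → M)
    (h : ∀ N ∈ R, ∀ ys : Fin n → N, (fun i => (ys i : M)) = xs → θ.all.Realize default ys) :
    θ.all.Realize default xs := by
  intro a
  refine ih _ fun N hN ys hys => ?_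
  have := h N hN (Fin.init ys) (by
    funext i
    have := congrFun hys i.castSucc
    simpa [Fin.init] using this) (ys (Fin.last n))
  rwa [Fin.snoc_init_self] at this

theorem IsSigmaOne.realize_of_isFinitaryCover {M : Type w} [L.Structure M]
    {R : Set (L.Substructure M)} (hR : IsFinitaryCover R) {n : ℕ} {θ : L.BoundedFormula Empty n}
    (hθ : IsSigmaOne θ) (xs : Fin n → M)
    (h : ∀ N ∈ R, ∀ ys : Fin n → N, (fun i => (ys i : M)) = xs → θ.Realize default ys) :
    θ.Realize default xs := by
  obtain ⟨N, hN, hxs⟩ := hR (Set.range xs) (Set.finite_range xs)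
  have := hθ.isExistential.realize_embedding N.subtype
    (h N hN (fun i => ⟨xs i, hxs ⟨i, rfl⟩⟩) rfl)
  rwa [Subsingleton.elim (N.subtype ∘ default) default] at this

theorem IsPiTwo.realize_of_isFinitaryCover {M : Type w} [L.Structure M]
    {R : Set (L.Substructure M)} (hR : IsFinitaryCover R) {n : ℕ} {θ : L.BoundedFormula Empty n}
    (hθ : IsPiTwo θ) (xs : Fin n → M)
    (h : ∀ N ∈ R, ∀ ys : Fin n → N, (fun i => (ys i : M)) = xs → θ.Realize default ys) :
    θ.Realize default xs := by
  induction hθ with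
  | all_of_isSigmaOne hθ =>
    exact realize_all_of_forall_mem_cover (hθ.realize_of_isFinitaryCover hR) xs h
  | all _ ih => exact realize_all_of_forall_mem_cover ih xs h

theorem IsPiTwo.preservedUnderFinitaryCoveredExtensions {ψ : L.Sentence} (hψ : IsPiTwo ψ) :
    PreservedUnderFinitaryCoveredExtensions (modelClass.{u, v, w} ψ) := by
  intro M _ R hR h
  obtain ⟨N, hN, -⟩ := hR ∅ Set.finite_empty
  obtain ⟨⟨x : N⟩, -⟩ := h N hN
  refine ⟨⟨(x : M)⟩, hψ.realize_of_isFinitaryCover hR _ fun N hN ys _ => ?_⟩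
  have := (h N hN).2
  rw [Subsingleton.elim ys default]
  exact this

/-! ### Building `Π₂` sentences -/

theorem BoundedFormula.IsQF.formula_relabel {α β : Type*} {θ : L.Formula α} (h : θ.IsQF)
    (g : α → β) : (θ.relabel g).IsQF :=
  h.relabel _

theorem BoundedFormula.IsQF.restrictFreeVar {α β : Type*} [DecidableEq α] {n : ℕ}
    {θ : L.BoundedFormula α n} (h : θ.IsQF) (f : θ.freeVarFinset → β) :
    (θ.restrictFreeVar f).IsQF := by
  induction h with
  | falsum => exact .falsum
  | of_isAtomic h =>
    cases h with
    | equal => exact (IsAtomic.equal _ _).isQF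
    | rel => exact (IsAtomic.rel _ _).isQF
  | imp _ _ ih₁ ih₂ => exact (ih₁ _).imp (ih₂ _)

theorem BoundedFormula.IsQF.iInf {α ι : Type*} [Finite ι] {θ : ι → L.Formula α}
    (h : ∀ i, (θ i).IsQF) : (Formula.iInf θ).IsQF := by
  have aux : ∀ l : List (L.Formula α), (∀ x ∈ l, BoundedFormula.IsQF x) →
      BoundedFormula.IsQF (l.foldr (· ⊓ ·) ⊤) := by
    intro l hl
    induction l with
    | nil => exact .top
    | cons a l ih =>
      exact (hl a (by simp)).inf (ih fun x hx => hl x (by simp [hx]))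
  unfold Formula.iInf BoundedFormula.iInf
  refine aux _ fun x hx => ?_
  obtain ⟨i, -, rfl⟩ := List.mem_map.1 hx
  exact h i

/-- A quantifier-free formula involves only finitely many of its variables, so all but finitely many
of the variables indexed by `γ` can be dropped. -/
theorem BoundedFormula.IsQF.exists_fin_variables {α γ : Type*} [Nonempty γ]
    {θ : L.Formula (α ⊕ γ)} (h : θ.IsQF) :
    ∃ (n : ℕ) (g : Fin (n + 1) → γ) (θ' : L.Formula (α ⊕ Fin (n + 1))),
      g.Injective ∧ θ'.IsQF ∧ ∀ (M : Type w) [L.Structure M] (a : α → M) (c : γ → M),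
        θ'.Realize (Sum.elim a (c ∘ g)) ↔ θ.Realize (Sum.elim a c) := by
  classical
  -- an extra element makes the set of variables non-empty
  obtain ⟨c₀⟩ := ‹Nonempty γ›
  let V : Finset γ := insert c₀ (θ.freeVarFinset.toRight)
  obtain ⟨n, hn⟩ : ∃ n, V.card = n + 1 :=
    Nat.exists_eq_succ_of_ne_zero (Finset.card_ne_zero.2 (Finset.insert_nonempty _ _))
  let e : V ≃ Fin (n + 1) := V.equivFinOfCardEq hn
  let f : θ.freeVarFinset → α ⊕ Fin (n + 1) := fun x =>
    match x with
    | ⟨.inl x, _⟩ => .inl x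
    | ⟨.inr x, hx⟩ => .inr (e ⟨x, Finset.mem_insert_of_mem (Finset.mem_toRight.2 hx)⟩)
  refine ⟨n, fun i => e.symm i, θ.restrictFreeVar f,
    Subtype.val_injective.comp e.symm.injective, h.restrictFreeVar f, fun M _ a c => ?_⟩
  refine BoundedFormula.realize_restrictFreeVar _ ?_
  rintro ⟨x | x, hx⟩ <;> simp [f]

/-- The sentence `∀ x ∃ y, θ(x, y)`, the tuples `x` and `y` being indexed by finite types. -/
noncomputable def piTwo {α β : Type*} [Finite α] [Finite β] (θ : L.Formula (α ⊕ β)) :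
    L.Sentence :=
  ((θ.relabel (Sum.map Sum.inr id) : L.Formula ((Empty ⊕ α) ⊕ β)).iExs β).iAlls α

theorem realize_piTwo {α β : Type*} [Finite α] [Finite β] {θ : L.Formula (α ⊕ β)}
    {M : Type*} [L.Structure M] :
    M ⊨ piTwo θ ↔ ∀ a : α → M, ∃ b : β → M, θ.Realize (Sum.elim a b) := by
  unfold piTwo Sentence.Realize
  rw [Formula.realize_iAlls]
  refine forall_congr' fun a => ?_
  rw [Formula.realize_iExs]
  refine exists_congr fun b => ?_
  rw [Formula.realize_relabel]
  apply iff_of_eq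
  congr 1
  funext x
  rcases x with x | x <;> rfl

theorem IsSigmaOne.exs {α : Type*} {n : ℕ} {θ : L.BoundedFormula α n} (h : IsSigmaOne θ) :
    IsSigmaOne θ.exs := by
  induction n with
  | zero => exact h
  | succ n ih => exact ih h.ex

theorem IsPiTwo.alls {α : Type*} {n : ℕ} {θ : L.BoundedFormula α n} (h : IsPiTwo θ) :
    IsPiTwo θ.alls := by
  induction n with
  | zero => exact h
  | succ n ih => exact ih h.all

theorem IsSigmaOne.relabel {α β : Type*} {m n : ℕ} {θ : L.BoundedFormula α m} (h : IsSigmaOne θ)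
    (g : α → β ⊕ Fin n) : IsSigmaOne (θ.relabel g) := by
  induction h with
  | ex_of_isQF h =>
    rw [BoundedFormula.relabel_ex]
    exact .ex_of_isQF (h.relabel g)
  | ex _ ih =>
    rw [BoundedFormula.relabel_ex]
    exact .ex ih

theorem BoundedFormula.IsQF.isSigmaOne_exs {α : Type*} {n : ℕ} [NeZero n]
    {θ : L.BoundedFormula α n} (h : θ.IsQF) : IsSigmaOne θ.exs := by
  obtain ⟨n, rfl⟩ := Nat.exists_eq_succ_of_ne_zero (NeZero.ne n)
  exact IsSigmaOne.exs (θ := θ.ex) (.ex_of_isQF h)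

theorem IsSigmaOne.isPiTwo_alls {α : Type*} {n : ℕ} [NeZero n]
    {θ : L.BoundedFormula α n} (h : IsSigmaOne θ) : IsPiTwo θ.alls := by
  obtain ⟨n, rfl⟩ := Nat.exists_eq_succ_of_ne_zero (NeZero.ne n)
  exact IsPiTwo.alls (θ := θ.all) (.all_of_isSigmaOne h)

theorem neZero_choose_exists_equiv_fin (β : Type*) [Finite β] [Nonempty β] :
    NeZero (Classical.choose (Finite.exists_equiv_fin β)) :=
  have ⟨e⟩ := Classical.choose_spec (Finite.exists_equiv_fin β)
  Fin.pos_iff_nonempty.2 (e.nonempty_congr.1 ‹_›) |>.ne' |> NeZero.mk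

theorem isSigmaOne_iExs {α β : Type*} [Finite β] [Nonempty β] {θ : L.Formula (α ⊕ β)}
    (h : θ.IsQF) : IsSigmaOne (θ.iExs β) :=
  have := neZero_choose_exists_equiv_fin β
  BoundedFormula.IsQF.isSigmaOne_exs (n := _ + 0) (h.relabel _)

theorem isPiTwo_iAlls {α β : Type*} [Finite β] [Nonempty β] {θ : L.Formula (α ⊕ β)}
    (h : IsSigmaOne θ) : IsPiTwo (θ.iAlls β) :=
  have := neZero_choose_exists_equiv_fin β
  IsSigmaOne.isPiTwo_alls (n := _ + 0) (h.relabel _)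

theorem isPiTwo_piTwo {α β : Type*} [Finite α] [Finite β] [Nonempty α] [Nonempty β]
    {θ : L.Formula (α ⊕ β)} (h : θ.IsQF) : IsPiTwo (piTwo θ) :=
  isPiTwo_iAlls (isSigmaOne_iExs (h.formula_relabel _))

/-- The set of consequences of `φ` of the form `∀ x ∃ y, θ(x, y)` with `θ` quantifier-free. The
tuples `x` and `y` are non-empty, as `IsPiTwo` requires. -/
def piTwoConsequences (φ : L.Sentence) : L.Theory :=
  {χ | ({φ} : L.Theory) ⊨ᵇ χ ∧ ∃ (m n : ℕ) (θ : L.Formula (Fin (m + 1) ⊕ Fin (n + 1))),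
    θ.IsQF ∧ χ = piTwo θ}

/-- Conjunctions of finitely many `Π₂` sentences are `Π₂`: the quantifiers of each kind are
merged by taking disjoint variables. -/
theorem exists_isPiTwo_of_finset_subset_piTwoConsequences {φ : L.Sentence}
    {T₀ : Finset L.Sentence} (hT₀ : (T₀ : L.Theory) ⊆ piTwoConsequences φ) :
    ∃ ψ : L.Sentence, IsPiTwo ψ ∧ ∀ (M : Type w) [L.Structure M] [Nonempty M],
      M ⊨ ψ ↔ M ⊨ (T₀ : L.Theory) := by
  choose m n θ hθ hχ using fun χ : T₀ => (hT₀ χ.2).2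
  let α := Σ χ : T₀, Fin (m χ + 1)
  let β := Σ χ : T₀, Fin (n χ + 1)
  -- `T₀` may be empty; the extra variables guarantee that both blocks of quantifiers are non-empty
  let θ' : T₀ → L.Formula (Option α ⊕ Option β) := fun χ =>
    (θ χ).relabel (Sum.map (fun i => some ⟨χ, i⟩) (fun i => some ⟨χ, i⟩))
  refine ⟨piTwo (Formula.iInf θ'),
    isPiTwo_piTwo (.iInf fun χ => (hθ χ).formula_relabel _), fun M _ _ => ?_⟩
  rw [realize_piTwo, Theory.model_iff]
  simp only [Formula.realize_iInf]
  have key : ∀ (χ : T₀) (a : Option α → M) (b : Option β → M),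
      (θ' χ).Realize (Sum.elim a b) ↔
        (θ χ).Realize (Sum.elim (fun i => a (some ⟨χ, i⟩)) (fun i => b (some ⟨χ, i⟩))) := by
    intro χ a b
    rw [Formula.realize_relabel]
    apply iff_of_eq
    congr 1
    funext x
    rcases x with x | x <;> rfl
  inhabit M
  constructor
  · intro h χ hχT
    rw [show χ = piTwo (θ ⟨χ, hχT⟩) from hχ ⟨χ, hχT⟩, realize_piTwo]
    intro a
    classical
    obtain ⟨b, hb⟩ := h (fun o => o.elim default fun p =>
      if hp : p.1 = ⟨χ, hχT⟩ then a (hp ▸ p.2) else default)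
    exact ⟨fun i => b (some ⟨⟨χ, hχT⟩, i⟩), by simpa using (key _ _ _).1 (hb ⟨χ, hχT⟩)⟩
  · intro h a
    have : ∀ χ : T₀, ∃ b : Fin (n χ + 1) → M,
        (θ χ).Realize (Sum.elim (fun i => a (some ⟨χ, i⟩)) b) := fun χ => by
      have := h χ χ.2
      rw [hχ χ, realize_piTwo] at this
      exact this _
    choose b hb using this
    exact ⟨fun o => o.elim default fun p => b p.1 p.2, fun χ => (key _ _ _).2 (hb χ)⟩

/-! ### Embedding models of `φ` into elementary extensions -/

/-- Entailment may be tested on the models in any universe large enough. -/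
theorem models_sentence_of_forall_models {T : L.Theory} {χ : L.Sentence}
    (h : ∀ M : ModelType.{u, v, max u v w} T, M ⊨ χ) : T ⊨ᵇ χ := by
  refine models_sentence_iff.2 fun M => ?_
  let e : M ≃ ULift.{max u v w} M := Equiv.ulift.symm
  let := e.inducedStructure (L := L)
  have : ULift.{max u v w} M ⊨ T := StrongHomClass.theory_model (e.inducedStructureEquiv (L := L))
  exact (StrongHomClass.realize_sentence (e.inducedStructureEquiv (L := L)) χ).2
    (h (ModelType.of T (ULift.{max u v w} M)))

/-- A map preserving the truth of all quantifier-free formulas is an embedding. -/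
def Embedding.ofRealizeQF {M N : Type*} [L.Structure M] [L.Structure N] (f : M → N)
    (h : ∀ θ : L.Formula M, θ.IsQF → θ.Realize id → θ.Realize f) : M ↪[L] N where
  toFun := f
  inj' x y hxy := by
    by_contra hne
    have := h ((Term.var x).equal (Term.var y)).not (BoundedFormula.IsAtomic.equal _ _).isQF.not
    rw [Formula.realize_not, Formula.realize_not, Formula.realize_equal,
      Formula.realize_equal] at this
    exact this hne hxy
  map_fun' F x := by
    have := h (((Term.func F fun i => Term.var (x i))).equal (Term.var (Structure.funMap F x)))
      (BoundedFormula.IsAtomic.equal _ _).isQF (by simp)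
    simpa [Function.comp_def] using this.symm
  map_rel' R x := by
    have hR : (R.formula fun i => Term.var (x i) : L.Formula M).IsQF :=
      (BoundedFormula.IsAtomic.rel _ _).isQF
    constructor
    · intro hx
      by_contra hn
      have := h _ hR.not
      rw [Formula.realize_not, Formula.realize_not, Formula.realize_rel,
        Formula.realize_rel] at this
      exact this hn hx
    · intro hx
      simpa [Formula.realize_rel, Function.comp_def] using
        h _ hR (by simpa [Formula.realize_rel] using hx)

/-- If `M` satisfies the `Π₂` consequences of `φ`, then for any finite tuple `a` of `M` there are a
model `N` of `φ` and a tuple `b` of `N` such that every existential formula true of `b` in `N` is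
true of `a` in `M`. Given finitely many existential formulas failing at `a`, some model of `φ` has
a tuple at which they fail as well: otherwise their disjunction, quantified universally, would be a
`Π₂` consequence of `φ` failing in `M`. Now `N` is an ultraproduct of such models. -/
theorem exists_model_existential_imp {φ : L.Sentence} {M : Type (max u v w)} [L.Structure M]
    [Nonempty M] (hM : M ⊨ piTwoConsequences φ) {k : ℕ} (a : Fin (k + 1) → M) :
    ∃ (N : ModelType.{u, v, max u v w} ({φ} : L.Theory)) (b : Fin (k + 1) → N),
      ∀ θ : L.Formula (Fin (k + 1) ⊕ ℕ), θ.IsQF → ∀ d : ℕ → N,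
        θ.Realize (Sum.elim b d) → ∃ d' : ℕ → M, θ.Realize (Sum.elim a d') := by
  let J := {θ : L.Formula (Fin (k + 1) ⊕ ℕ) //
    θ.IsQF ∧ ∀ d : ℕ → M, ¬ θ.Realize (Sum.elim a d)}
  have fin : ∀ j : Finset J, ∃ (N : ModelType.{u, v, max u v w} ({φ} : L.Theory))
      (b : Fin (k + 1) → N), ∀ θ ∈ j, ∀ d : ℕ → N, ¬ θ.1.Realize (Sum.elim b d) := by
    intro j
    by_contra! hcon
    -- the disjunction of the formulas in `j`
    let δ : L.Formula (Fin (k + 1) ⊕ ℕ) := (Formula.iInf fun θ : j => θ.1.1.not).not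
    have hδ : δ.IsQF := (BoundedFormula.IsQF.iInf fun θ : j => θ.1.2.1.not).not
    have hδr : ∀ (P : Type (max u v w)) [L.Structure P] (v : Fin (k + 1) ⊕ ℕ → P),
        δ.Realize v ↔ ∃ θ ∈ j, θ.1.Realize v := by
      intro P _ v
      simp [δ, Formula.realize_iInf]
    obtain ⟨n, g, δ', hg, hδ', hr⟩ := 
      BoundedFormula.IsQF.exists_fin_variables.{u, v, max u v w} hδ
    have hmem : piTwo δ' ∈ piTwoConsequences φ := by
      refine ⟨models_sentence_of_forall_models.{u, v, w} fun P => realize_piTwo.2 fun b => ?_,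
        _, _, δ', hδ', rfl⟩
      obtain ⟨θ, hθ, d, hd⟩ := hcon P b
      exact ⟨d ∘ g, (hr P b d).2 ((hδr P _).2 ⟨θ, hθ, hd⟩)⟩
    obtain ⟨c, hc⟩ := realize_piTwo.1 ((piTwoConsequences φ).realize_sentence_of_mem hmem) a
    inhabit M
    rw [← Function.extend_comp hg c default, hr, hδr] at hc
    obtain ⟨θ, -, hθ⟩ := hc
    exact θ.2.2 _ hθ
  choose N b hb using fin
  let U : Ultrafilter (Finset J) := Ultrafilter.of Filter.atTop
  have hφ : (U : Filter (Finset J)).Product (fun j => N j) ⊨ ({φ} : L.Theory) := by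
    rw [Theory.model_singleton_iff, Ultraproduct.sentence_realize]
    exact .of_forall fun j => Theory.realize_sentence_of_mem {φ} rfl
  refine ⟨ModelType.of {φ} ((U : Filter (Finset J)).Product (fun j => N j)),
    fun i => ((fun j => b j i : ∀ j, N j) : (U : Filter (Finset J)).Product (fun j => N j)),
    fun θ hθ d hd => ?_⟩
  by_contra! hcon
  have hJ : ∀ᶠ j in (U : Filter (Finset J)), (⟨θ, hθ, hcon⟩ : J) ∈ j :=
    Ultrafilter.of_le _ <| Filter.eventually_atTop.2
      ⟨{⟨θ, hθ, hcon⟩}, fun j hj => hj (Finset.mem_singleton_self _)⟩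
  obtain ⟨d, rfl⟩ : ∃ d' : ℕ → ∀ j, N j,
      d = fun i => (d' i : (U : Filter (Finset J)).Product (fun j => N j)) :=
    ⟨fun i => (d i).out, funext fun i => (Quotient.out_eq _).symm⟩
  have hd' : ∀ᶠ j in (U : Filter (Finset J)),
      θ.Realize (fun x => Sum.elim (fun i j => b j i) d x j) := by
    rw [← Ultraproduct.realize_formula_cast]
    refine Eq.mp (congrArg θ.Realize (funext fun x => ?_)) hd
    rcases x with x | x <;> rfl
  obtain ⟨j, hj, hj'⟩ := (hJ.and hd').exists
  refine hb j _ hj (fun i => d i j) ?_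
  convert hj' using 1
  funext x
  rcases x with x | x <;> rfl

/-- The diagonal embedding of a structure into an ultrapower. -/
noncomputable def ElementaryEmbedding.diagonal {I : Type*} (U : Ultrafilter I) (M : Type*)
    [L.Structure M] [Nonempty M] : M ↪ₑ[L] (U : Filter I).Product (fun _ => M) where
  toFun m := ((fun _ => m : I → M) : (U : Filter I).Product (fun _ => M))
  map_formula' _ θ x := by
    refine (Ultraproduct.realize_formula_cast θ (fun i _ => x i)).trans ?_
    exact Filter.eventually_const

/-- Every model `M` of the `Π₂` consequences of `φ` has an elementary extension in which each finite
tuple of `M` is contained in a substructure satisfying `φ`. For each tuple `a`, choose `N` and `b`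
as in `exists_model_existential_imp`. Finitely many quantifier-free facts about `b` and `N` hold of
`a` and suitable elements of `M`, so an ultrapower of `M` contains a copy of `N` with `b` mapped
to `a`, simultaneously for all `a`. -/
theorem exists_elementaryEmbedding_forall_tuple {φ : L.Sentence}
    (M : ModelType.{u, v, max u v w} (piTwoConsequences φ)) :
    ∃ (M' : ModelType.{u, v, max u v w} (piTwoConsequences φ)) (f : M ↪ₑ[L] M'),
      ∀ (k : ℕ) (a : Fin (k + 1) → M), ∃ S : L.Substructure M', S ⊨ φ ∧ ∀ i, f (a i) ∈ S := by
  let X := Σ k : ℕ, (Fin (k + 1) → M)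
  choose N b hN using fun x : X =>
    exists_model_existential_imp.{u, v, w} (φ := φ) (M := M) inferInstance x.2
  -- the quantifier-free diagram of `N x`, with the entries of the tuple `x` naming those of `b x`
  let D : X → Type (max u v w) := fun x =>
    {θ : L.Formula (Fin (x.1 + 1) ⊕ N x) // θ.IsQF ∧ θ.Realize (Sum.elim (b x) id)}
  let I := Finset (Σ x, D x)
  have fin : ∀ (j : I) (x : X), ∃ h : N x → M, ∀ θ : D x, ⟨x, θ⟩ ∈ j →
      θ.1.Realize (Sum.elim x.2 h) := by
    intro j x
    have : Finite {p : D x // (⟨x, p⟩ : Σ x, D x) ∈ j} :=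
      Finite.of_injective (fun p => (⟨⟨x, p.1⟩, p.2⟩ : j)) fun p q hpq => by
        simpa [Subtype.ext_iff] using hpq
    -- the conjunction of the part of the diagram of `N x` occurring in `j`
    let δ : L.Formula (Fin (x.1 + 1) ⊕ N x) :=
      Formula.iInf fun p : {p : D x // (⟨x, p⟩ : Σ x, D x) ∈ j} => p.1.1
    have hδ : δ.IsQF := .iInf fun p => p.1.2.1
    obtain ⟨n, e, δ', he, hδ', hr⟩ :=
      BoundedFormula.IsQF.exists_fin_variables.{u, v, max u v w} hδ
    have hδN : δ'.Realize (Sum.elim (b x) e) :=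
      (hr (N x) (b x) id).2 (Formula.realize_iInf.2 fun p => p.1.2.2)
    have : Inhabited (N x) := Classical.inhabited_of_nonempty'
    have : Inhabited M := Classical.inhabited_of_nonempty'
    have hval : Function.Injective (Fin.val : Fin (n + 1) → ℕ) := Fin.val_injective
    -- the property of `N x` concerns variables indexed by `ℕ`, so rename `Fin (n + 1)` into `ℕ`
    obtain ⟨d, hd⟩ := hN x (δ'.relabel (Sum.map id Fin.val)) (hδ'.formula_relabel _)
      (Function.extend Fin.val e default) (by
        rw [Formula.realize_relabel, Sum.elim_comp_map, Function.extend_comp hval]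
        exact hδN)
    rw [Formula.realize_relabel, Sum.elim_comp_map, Function.comp_id,
      ← Function.extend_comp he (d ∘ Fin.val) default, hr, Formula.realize_iInf] at hd
    exact ⟨_, fun θ hθ => hd ⟨θ, hθ⟩⟩
  choose h hh using fin
  let U : Ultrafilter I := Ultrafilter.of Filter.atTop
  have hUmem : ∀ p : Σ x, D x, ∀ᶠ j in (U : Filter I), p ∈ j := fun p =>
    Ultrafilter.of_le _ <| Filter.eventually_atTop.2
      ⟨{p}, fun j hj => hj (Finset.mem_singleton_self _)⟩
  let M' := (U : Filter I).Product (fun _ => (M : Type (max u v w)))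
  let f : M ↪ₑ[L] M' := .diagonal U M
  have hM' : M' ⊨ piTwoConsequences φ := (f.theory_model_iff _).1 inferInstance
  refine ⟨ModelType.of _ M', f, fun k a => ?_⟩
  let x : X := ⟨k, a⟩
  let c : N x → M' := fun y => ((fun j => h j x y : I → M) : (U : Filter I).Product (fun _ => M))
  have hc : ∀ θ : L.Formula (Fin (k + 1) ⊕ N x), θ.IsQF → θ.Realize (Sum.elim (b x) id) →
      θ.Realize (Sum.elim (fun i => f (a i)) c) := by
    intro θ hθ hr
    have : ∀ᶠ j in (U : Filter I),
        θ.Realize (fun y => Sum.elim (fun i _ => a i) (fun y j => h j x y) y j) := by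
      filter_upwards [hUmem ⟨x, θ, hθ, hr⟩] with j hj
      refine Eq.mp (congrArg θ.Realize (funext fun y => ?_)) (hh j x ⟨θ, hθ, hr⟩ hj)
      rcases y with y | y <;> rfl
    rw [← Ultraproduct.realize_formula_cast] at this
    refine Eq.mp (congrArg θ.Realize (funext fun x => ?_)) this
    rcases x with x | x <;> rfl
  let g : N x ↪[L] M' := .ofRealizeQF c fun θ hθ hr => by
    have := hc (θ.relabel Sum.inr) (hθ.formula_relabel _) (by simpa using hr)
    simpa using this
  refine ⟨g.toHom.range, ?_, fun i => ⟨b x i, ?_⟩⟩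
  · exact (StrongHomClass.realize_sentence g.equivRange φ).1
      (Theory.realize_sentence_of_mem {φ} rfl)
  · have := hc ((Term.var (.inl i)).equal (Term.var (.inr (b x i))))
      (BoundedFormula.IsAtomic.equal _ _).isQF (by simp)
    rw [Formula.realize_equal] at this
    exact this.symm

/-! ### Elementary chains -/

/-- The structures of a directed system of elementary embeddings embed elementarily into its
direct limit. -/
theorem DirectLimit.realize_of {ι : Type*} [Preorder ι] [IsDirectedOrder ι] [Nonempty ι]
    {G : ι → Type*} [∀ i, L.Structure (G i)] (f : ∀ i j, i ≤ j → G i ↪[L] G j)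
    [DirectedSystem G fun i j h => f i j h]
    (hf : ∀ i j (h : i ≤ j) {n : ℕ} (θ : L.BoundedFormula Empty n) (xs : Fin n → G i),
      θ.Realize default (f i j h ∘ xs) ↔ θ.Realize default xs)
    {n : ℕ} (θ : L.BoundedFormula Empty n) (i : ι) (xs : Fin n → G i) :
    θ.Realize default (DirectLimit.of L ι G f i ∘ xs) ↔ θ.Realize default xs := by
  induction θ generalizing i with
  | falsum => rfl
  | equal t₁ t₂ =>
    have := (BoundedFormula.IsAtomic.equal t₁ t₂).isQF.realize_embedding
      (DirectLimit.of L ι G f i) (v := default) (xs := xs)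
    rwa [Subsingleton.elim (_ ∘ default) default] at this
  | rel R ts =>
    have := (BoundedFormula.IsAtomic.rel R ts).isQF.realize_embedding
      (DirectLimit.of L ι G f i) (v := default) (xs := xs)
    rwa [Subsingleton.elim (_ ∘ default) default] at this
  | imp θ₁ θ₂ ih₁ ih₂ => simp only [BoundedFormula.realize_imp, ih₁, ih₂]
  | all θ ih =>
    simp only [BoundedFormula.realize_all]
    constructor
    · intro h a
      rw [← ih i, Fin.comp_snoc]
      exact h _
    · intro h z
      obtain ⟨j, y, rfl⟩ := DirectLimit.exists_of z
      -- the new element `y` lives at some stage `j`; pass to a stage beyond both `i` and `j`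
      obtain ⟨k, hik, hjk⟩ := exists_ge_ge i j
      have hk : θ.all.Realize default (f i k hik ∘ xs) := (hf i k hik θ.all xs).2 h
      have := (ih k _).2 (hk (f j k hjk y))
      rw [Fin.comp_snoc, DirectLimit.of_f] at this
      convert this using 2
      funext x
      exact DirectLimit.of_f.symm

/-- In a chain of elementary embeddings, all compositions are elementary. -/
theorem DirectedSystem.realize_natLERec {G : ℕ → Type*} [∀ i, L.Structure (G i)]
    (f : ∀ n, G n ↪ₑ[L] G (n + 1)) (i j : ℕ) (h : i ≤ j) {n : ℕ}
    (θ : L.BoundedFormula Empty n) (xs : Fin n → G i) :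
    θ.Realize default (natLERec (fun n => (f n).toEmbedding) i j h ∘ xs) ↔
      θ.Realize default xs := by
  induction j, h using Nat.le_induction with
  | base =>
    rw [show natLERec (fun n => (f n).toEmbedding) i i le_rfl ∘ xs = xs from
      funext fun x => DirectedSystem.map_self'
        (f := fun i j h => natLERec (fun n => (f n).toEmbedding) i j h) _]
  | succ j hij ih =>
    rw [← ih, ← (f j).map_boundedFormula, Subsingleton.elim (f j ∘ default) default]
    apply iff_of_eq
    congr 1
    funext x
    simp [Nat.leRecOn_succ hij]

/-- The limit of an elementary chain is an elementary extension of its first member. If every finite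
tuple of each member lies in a substructure of the next one satisfying `φ`, then the
non-empty substructures satisfying `φ` form a finitary cover of the limit. -/
theorem exists_elementaryEmbedding_isFinitaryCover {φ : L.Sentence} {G : ℕ → Type w}
    [∀ i, L.Structure (G i)] [Nonempty (G 0)] (e : ∀ n, G n ↪ₑ[L] G (n + 1))
    (he : ∀ n k (a : Fin (k + 1) → G n),
      ∃ S : L.Substructure (G (n + 1)), S ⊨ φ ∧ ∀ i, e n (a i) ∈ S) :
    ∃ (D : Type w) (_ : L.Structure D), Nonempty (G 0 ↪ₑ[L] D) ∧
      IsFinitaryCover {S : L.Substructure D | Nonempty S ∧ S ⊨ φ} := by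
  let F : ∀ i j, i ≤ j → G i ↪[L] G j := DirectedSystem.natLERec fun n => (e n).toEmbedding
  have : DirectedSystem G fun i j h => F i j h :=
    DirectedSystem.natLERec.directedSystem fun n => (e n).toEmbedding
  let o : ∀ i, G i ↪[L] DirectLimit G F := DirectLimit.of L ℕ G F
  refine ⟨DirectLimit G F, inferInstance, ⟨⟨o 0, fun n θ xs => ?_⟩⟩, fun S hS => ?_⟩
  · rw [← Formula.realize_relabel_sumInr (v := default),
      DirectLimit.realize_of F (DirectedSystem.realize_natLERec e)]
    exact Formula.realize_relabel_sumInr θ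
  · obtain ⟨x₀⟩ : Nonempty (G 0) := inferInstance
    obtain ⟨k, s, rfl⟩ := hS.fin_embedding
    -- `x₀` is added to the given finite set, which may be empty, to get a non-empty tuple
    obtain ⟨i, y, hy⟩ := DirectLimit.exists_quotient_mk'_sigma_mk'_eq G F
      (Fin.cons (o 0 x₀) s : Fin (k + 1) → _)
    obtain ⟨N, hN, hyN⟩ := he i k y
    refine ⟨N.map (o (i + 1)).toHom, ⟨⟨o (i + 1) (e i (y 0)), e i (y 0), hyN 0, rfl⟩, ?_⟩, ?_⟩
    · exact (StrongHomClass.realize_sentence ((o (i + 1)).substructureEquivMap N) φ).1 hN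
    · rintro _ ⟨x, rfl⟩
      refine ⟨e i (y x.succ), hyN _, ?_⟩
      have h₁ : s x = o i (y x.succ) := congrFun hy x.succ
      have h₂ : F i (i + 1) (Nat.le_succ i) (y x.succ) = e i (y x.succ) := by
        simp [F, Nat.leRecOn_succ le_rfl, Nat.leRecOn_self]
      rw [h₁, ← h₂]
      exact DirectLimit.of_f

/-! ### The preservation theorem -/

/-- A sentence preserved under finitary covered extensions follows from its `Π₂` consequences:
a model of these is the start of an elementary chain whose limit is covered by models of `φ`. -/
theorem PreservedUnderFinitaryCoveredExtensions.piTwoConsequences_models {φ : L.Sentence}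
    (h : PreservedUnderFinitaryCoveredExtensions (modelClass.{u, v, max u v w} φ)) :
    piTwoConsequences φ ⊨ᵇ φ := by
  refine models_sentence_of_forall_models.{u, v, w} fun M => ?_
  choose next f hf using exists_elementaryEmbedding_forall_tuple.{u, v, w} (φ := φ)
  let G : ℕ → ModelType.{u, v, max u v w} (piTwoConsequences φ) := fun n => next^[n] M
  have hG : ∀ n, G (n + 1) = next (G n) := fun n => Function.iterate_succ_apply' next n M
  have step : ∀ n, ∃ e : (G n).Carrier ↪ₑ[L] (G (n + 1)).Carrier,
      ∀ k (a : Fin (k + 1) → G n),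
        ∃ S : L.Substructure (G (n + 1)), S ⊨ φ ∧ ∀ i, e (a i) ∈ S := by
    intro n
    rw [hG]
    exact ⟨f (G n), hf (G n)⟩
  choose e he using step
  have : Nonempty (G 0) := (G 0).nonempty'
  obtain ⟨D, _, ⟨g⟩, hD⟩ := exists_elementaryEmbedding_isFinitaryCover
    (G := fun n => (G n).Carrier) e he
  exact (g.map_sentence φ).2 (h D _ hD fun _ hN => hN).2

theorem preservedUnderFinitaryCoveredExtensions_iff_exists_isPiTwo {φ : L.Sentence} :
    PreservedUnderFinitaryCoveredExtensions (modelClass.{u, v, max u v w} φ) ↔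
      ∃ ψ : L.Sentence, IsPiTwo ψ ∧ (∅ : L.Theory).Iff φ ψ := by
  constructor
  · intro h
    obtain ⟨T₀, hT₀, hφ⟩ := models_iff_finset_models.1 h.piTwoConsequences_models
    obtain ⟨ψ, hψ, hr⟩ := exists_isPiTwo_of_finset_subset_piTwoConsequences.{u, v, max u v} hT₀
    refine ⟨ψ, hψ, models_sentence_iff.2 fun M => (Sentence.realize_iff _).2
      ⟨fun hM => ?_, fun hM => ?_⟩⟩
    · have : M ⊨ ({φ} : L.Theory) := Theory.model_singleton_iff.2 hM
      exact (hr M).2 ⟨fun χ hχ => (hT₀ hχ).1.realize_sentence M⟩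
    · have := (hr M).1 hM
      exact hφ.realize_sentence M
  · rintro ⟨ψ, hψ, hiff⟩
    have : modelClass.{u, v, max u v w} φ = modelClass ψ := by
      ext M
      refine and_congr_right fun hM => ?_
      exact (Sentence.realize_iff _).1 (ModelsBoundedFormula.realize_sentence hiff M)
    rw [this]
    exact hψ.preservedUnderFinitaryCoveredExtensions

end FirstOrder.Language

theorem mainTheorem7 (L : FirstOrder.Language.{u, v}) (φ : L.Sentence) :
    FirstOrder.Language.PreservedUnderFinitaryCoveredExtensions
        (FirstOrder.Language.modelClass.{u, v, max u v w} φ) ↔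
      ∃ ψ : L.Sentence, FirstOrder.Language.IsPiTwo ψ ∧
        (∅ : L.Theory).Iff φ ψ :=
  FirstOrder.Language.preservedUnderFinitaryCoveredExtensions_iff_exists_isPiTwo.{u, v, w}
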